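/- Let $k\ge 0$ be a fixed integer. For each integer $a\ge 1$ let $X_1,X_2,\dots$ be independent random letters, each uniformly distributed on an alphabet of size $a$. A finite sequence of letters is called $k$-omni if every one of the $a^k$ words of length $k$ over the alphabet occurs in it as a (not necessarily contiguous) subsequence, and $W_{k,a}$ denotes the least $n$ such that $(X_1,\dots,X_n)$ is $k$-omni ($W_{k,a}=\infty$ if there is no such $n$). Then $W_{k,a}<\infty$ almost surely for every $a \geq 1$, and for every real $x$ $$\mathbb P\left(\frac{W_{k,a}-ka\log a}{a}\le x\right)\longrightarrow\Psi(x)\qquad(a\to\infty),$$ where $\Psi$ is the distribution function of the sum of $k$ independent standard Gumbel variables, that is, variables with distribution function $y\mapsto\exp(-e^{-y})$. -/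

import Mathlib

open MeasureTheory ProbabilityTheory Filter Topology

/-- A finite sequence `S` over the alphabet `α` is `k`-omni if each of the words of length `k` over
`α` occurs in `S` as a (not necessarily contiguous) subsequence. -/
def IsOmni {α : Type*} (k : ℕ) (S : List α) : Prop :=
  ∀ w : List α, w.length = k → w.Sublist S

/-- The waiting time until the infinite sequence of letters `x 0, x 1, x 2, …` becomes `k`-omni: the
least `n` such that the sequence of its first `n` letters is `k`-omni (and `⊤` if there is no such
`n`). -/
noncomputable def omniTime {α : Type*} (k : ℕ) (x : ℕ → α) : ℕ∞ :=
  ⨅ (n : ℕ) (_ : IsOmni k (List.ofFn fun i : Fin n => x i)), (n : ℕ∞)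

/-- The standard Gumbel distribution function `x ↦ exp (-e^(-x))`. -/
noncomputable def gumbelCDF : StieltjesFunction ℝ where
  toFun x := Real.exp (-Real.exp (-x))
  mono' x y h := by
    apply Real.exp_le_exp.2
    exact neg_le_neg (Real.exp_le_exp.2 (neg_le_neg h))
  right_continuous' x := by
    apply Continuous.continuousWithinAt
    fun_prop

/-- The standard Gumbel distribution on `ℝ`: the measure whose distribution function is
`x ↦ exp (-e^(-x))`. -/
noncomputable def gumbelMeasure : Measure ℝ := gumbelCDF.measure

theorem gumbelCDF_tendsto_atBot : Tendsto gumbelCDF atBot (𝓝 0) := by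
  change Tendsto (fun x : ℝ => Real.exp (-Real.exp (-x))) atBot (𝓝 0)
  exact Real.tendsto_exp_neg_atTop_nhds_zero.comp
    (Real.tendsto_exp_atTop.comp tendsto_neg_atBot_atTop)

theorem gumbelCDF_tendsto_atTop : Tendsto gumbelCDF atTop (𝓝 1) := by
  change Tendsto (fun x : ℝ => Real.exp (-Real.exp (-x))) atTop (𝓝 1)
  have h : Tendsto (fun x : ℝ => -Real.exp (-x)) atTop (𝓝 (-0)) :=
    Real.tendsto_exp_neg_atTop_nhds_zero.neg
  rw [neg_zero] at h
  simpa [Function.comp_def] using (Real.continuous_exp.tendsto 0).comp h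

instance instIsProbabilityMeasureGumbel : IsProbabilityMeasure gumbelMeasure :=
  gumbelCDF.isProbabilityMeasure gumbelCDF_tendsto_atBot gumbelCDF_tendsto_atTop

theorem gumbelMeasure_Iic (x : ℝ) :
    gumbelMeasure (Set.Iic x) = ENNReal.ofReal (Real.exp (-Real.exp (-x))) := by
  rw [gumbelMeasure, gumbelCDF.measure_Iic gumbelCDF_tendsto_atBot, sub_zero]
  rfl

/-- The distribution function of the sum of `k` independent standard Gumbel variables, realized as
the coordinates of the product probability space `(ℝ ^ k, gumbelMeasure ^ ⊗ k)`. -/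
noncomputable def gumbelSumCDF (k : ℕ) (x : ℝ) : ℝ :=
  (Measure.pi fun _ : Fin k => gumbelMeasure).real {g | ∑ i, g i ≤ x}

/-! Cut the sequence greedily into arches, each ending as soon as every letter has appeared since
the last cut. A sequence is `k`-omni exactly when it contains `k` arches, so the waiting time is a
sum of `k` coupon collector's times (`omniTime_succ`). These are independent and identically
distributed, because each arch reads fresh letters. Hence its characteristic function is the `k`th
power of that of one coupon time (`charFun_omniTime`).

For one coupon time, inclusion–exclusion over the missing letters gives the exact distribution
function (`real_omniTime_one_le`). At `n = a log a + x a + o(a)` its `j`th term tends to `(-1)^j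
e^(-jx) / j!`, and dominated convergence sums these limits to `exp (-e^(-x))`
(`tendsto_sum_choose_mul`). Lévy's continuity theorem carries the limit to `k`th powers
(`tendsto_law`). For `k ≥ 1` the Gumbel sum has no atoms, so the distribution functions converge at
every `x`; for `k = 0` they agree exactly. -/

/-! ### Arch decomposition -/

section Combinatorics

variable {α : Type*}

theorem IsOmni.of_sublist {k : ℕ} {S S' : List α} (h : IsOmni k S) (hS : S.Sublist S') :
    IsOmni k S' :=
  fun w hw => (h w hw).trans hS

theorem isOmni_zero (S : List α) : IsOmni 0 S := by
  intro w hw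
  rw [List.length_eq_zero_iff.1 hw]
  exact List.nil_sublist S

theorem isOmni_one_iff {S : List α} : IsOmni 1 S ↔ ∀ c, c ∈ S := by
  constructor
  · intro h c
    exact List.singleton_sublist.1 (h [c] rfl)
  · intro h w hw
    obtain ⟨c, rfl⟩ := List.length_eq_one_iff.1 hw
    exact List.singleton_sublist.2 (h c)

theorem IsOmni.mem_of_succ {k : ℕ} {S : List α} (h : IsOmni (k + 1) S) (c : α) : c ∈ S :=
  (h (List.replicate (k + 1) c) (by simp)).subset (by simp)

theorem IsOmni.append {k : ℕ} {A B : List α} (hA : ∀ c, c ∈ A) (hB : IsOmni k B) :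
    IsOmni (k + 1) (A ++ B) := by
  rintro (_ | ⟨d, w⟩) hw
  · simp at hw
  · exact (List.singleton_sublist.2 (hA d)).append (hB w (by simpa using hw))

/-- A prefix containing `c` must extend past `A`, so whatever follows an occurrence of `c` lies in
`B`. -/
theorem IsOmni.of_append {k : ℕ} {A B : List α} {c : α} (hc : c ∉ A)
    (h : IsOmni (k + 1) (A ++ c :: B)) : IsOmni k B := by
  intro w hw
  obtain ⟨r₁, r₂, e, h₁, h₂⟩ := List.cons_sublist_iff.1 (h (c :: w) (by simp [hw]))
  have hlen : ∃ l, r₁ = A ++ c :: l := by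
    rcases List.append_eq_append_iff.1 e with ⟨l, hl, hl'⟩ | ⟨l, hl, hl'⟩
    · rcases l with _ | ⟨d, l⟩
      · exact absurd h₁ (by simpa [hl] using hc)
      · simp only [List.cons_append, List.cons.injEq] at hl'
        exact ⟨l, by rw [hl, hl'.1]⟩
    · exact absurd (by rw [hl]; exact List.mem_append_left _ h₁) hc
  obtain ⟨l, rfl⟩ := hlen
  have : B = l ++ r₂ := by simpa using e
  rw [this]
  exact h₂.trans (List.sublist_append_right _ _)

theorem ofFn_add_eq_append (x : ℕ → α) (m l : ℕ) :
    (List.ofFn fun i : Fin (m + l) => x i) =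
      (List.ofFn fun i : Fin m => x i) ++ List.ofFn fun i : Fin l => x (m + i) := by
  rw [← List.ofFn_fin_append]
  congr 1
  funext i
  refine Fin.addCases (fun j => ?_) (fun j => ?_) i <;> simp

theorem IsOmni.mono {k : ℕ} {x : ℕ → α} {m n : ℕ} (h : IsOmni k (List.ofFn fun i : Fin m => x i))
    (hmn : m ≤ n) : IsOmni k (List.ofFn fun i : Fin n => x i) := by
  obtain ⟨l, rfl⟩ := Nat.exists_eq_add_of_le hmn
  rw [ofFn_add_eq_append]
  exact h.of_sublist (List.sublist_append_left _ _)

theorem omniTime_le_iff {k : ℕ} {x : ℕ → α} {n : ℕ} :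
    omniTime k x ≤ n ↔ IsOmni k (List.ofFn fun i : Fin n => x i) := by
  constructor
  · intro h
    have h' : omniTime k x < ((n + 1 : ℕ) : ℕ∞) :=
      h.trans_lt (by exact_mod_cast Nat.lt_succ_self n)
    simp only [omniTime, iInf_lt_iff] at h'
    obtain ⟨m, hm, hmn⟩ := h'
    exact hm.mono (Nat.lt_succ_iff.1 (by exact_mod_cast hmn))
  · intro h
    exact iInf₂_le n h

theorem omniTime_zero (x : ℕ → α) : omniTime 0 x = 0 :=
  le_antisymm (omniTime_le_iff.2 (isOmni_zero _)) bot_le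

theorem omniTime_one_le_iff {x : ℕ → α} {n : ℕ} :
    omniTime 1 x ≤ n ↔ ∀ c, ∃ i < n, x i = c := by
  simp only [omniTime_le_iff, isOmni_one_iff, List.mem_ofFn]
  refine forall_congr' fun c => ⟨fun ⟨i, hi⟩ => ⟨i, i.2, hi⟩, fun ⟨i, hi, h⟩ => ⟨⟨i, hi⟩, h⟩⟩

theorem ENat.eq_of_forall_le_natCast_iff {m n : ℕ∞} (h : ∀ a : ℕ, m ≤ a ↔ n ≤ a) : m = n := by
  apply le_antisymm
  · cases n with
    | top => exact le_top
    | coe n => exact (h n).2 le_rfl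
  · cases m with
    | top => exact le_top
    | coe m => exact (h m).1 le_rfl

/-- The first arch of a sequence is its shortest prefix containing all letters; the remaining `k`
arches are those of the rest of the sequence. -/
theorem omniTime_succ [Nonempty α] {k : ℕ} {x : ℕ → α} {m : ℕ} (hm : omniTime 1 x = m) :
    omniTime (k + 1) x = m + omniTime k (fun n => x (m + n)) := by
  apply ENat.eq_of_forall_le_natCast_iff
  intro n
  have hall : ∀ c, ∃ i < m, x i = c := omniTime_one_le_iff.1 hm.le
  rcases lt_or_ge n m with hnm | hmn
  · refine iff_of_false (fun h => ?_) (fun h => ?_)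
    · have : omniTime 1 x ≤ n := by
        rw [omniTime_le_iff, isOmni_one_iff]
        exact (omniTime_le_iff.1 h).mem_of_succ
      rw [hm] at this
      exact absurd (by exact_mod_cast this) (not_le.2 hnm)
    · have : (m : ℕ∞) ≤ n := le_self_add.trans h
      exact absurd (by exact_mod_cast this) (not_le.2 hnm)
  · obtain ⟨l, rfl⟩ := Nat.exists_eq_add_of_le hmn
    rw [Nat.cast_add, (ENat.addLECancellable_of_ne_top (ENat.natCast_ne_top m)).add_le_add_iff_left,
      ← Nat.cast_add, omniTime_le_iff, omniTime_le_iff, ofFn_add_eq_append]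
    constructor
    · obtain ⟨c⟩ := ‹Nonempty α›
      obtain ⟨p, rfl⟩ : ∃ p, m = p + 1 := by
        obtain ⟨i, hi, -⟩ := hall c
        exact ⟨m - 1, by omega⟩
      -- By minimality of `m = p + 1` some letter is missing from the first `p`. It must be `x p`,
      -- so the arch ends at a first occurrence, as `IsOmni.of_append` requires.
      obtain ⟨d, hd⟩ : ∃ d, ∀ i < p, x i ≠ d := by
        by_contra! hcon
        have := omniTime_one_le_iff.2 hcon
        rw [hm] at this
        have : p + 1 ≤ p := by exact_mod_cast this
        omega
      have hpd : x p = d := by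
        obtain ⟨i, hi, h⟩ := hall d
        rcases Nat.lt_succ_iff_lt_or_eq.1 hi with h' | rfl
        · exact absurd h (hd i h')
        · exact h
      intro h
      rw [ofFn_add_eq_append x p 1, List.append_assoc] at h
      refine IsOmni.of_append (c := d) (A := List.ofFn fun i : Fin p => x i) ?_ ?_
      · rw [List.mem_ofFn]
        rintro ⟨i, hi⟩
        exact hd i i.2 hi
      · simpa [hpd] using h
    · intro h
      refine IsOmni.append (fun c => ?_) h
      obtain ⟨i, hi, hc⟩ := hall c
      exact (List.mem_ofFn).2 ⟨⟨i, hi⟩, hc⟩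

end Combinatorics

/-! ### Measurability of the waiting time -/

section Measurability

variable {α Ω : Type*} [MeasurableSpace α] [Finite α] [MeasurableSingletonClass α]

/-- Only the first `n` letters need be measurable, so the σ-algebra on `Ω` may later be the one they
generate. -/
theorem measurableSet_omniTime_le [MeasurableSpace Ω] {X : ℕ → Ω → α} {n : ℕ}
    (hX : ∀ i < n, Measurable (X i)) (k : ℕ) :
    MeasurableSet {ω | omniTime k (fun i => X i ω) ≤ n} := by
  have hm : Measurable fun (ω : Ω) (i : Fin n) => X i ω :=
    measurable_pi_iff.2 fun i => hX i i.2
  have hs : MeasurableSet {y : Fin n → α | IsOmni k (List.ofFn y)} := Set.Finite.measurableSet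
    (Set.toFinite _)
  simp only [omniTime_le_iff]
  exact hm hs

theorem measurableSet_omniTime_eq [MeasurableSpace Ω] {X : ℕ → Ω → α} {n : ℕ}
    (hX : ∀ i < n, Measurable (X i)) (k : ℕ) :
    MeasurableSet {ω | omniTime k (fun i => X i ω) = n} := by
  have : {ω | omniTime k (fun i => X i ω) = n} =
      {ω | omniTime k (fun i => X i ω) ≤ n} \ ⋃ j ∈ Finset.range n,
        {ω | omniTime k (fun i => X i ω) ≤ (j : ℕ)} := by
    ext ω
    simp only [Set.mem_ofPred_eq, Set.mem_sdiff, Set.mem_iUnion, Finset.mem_range, not_exists,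
      not_le]
    constructor
    · intro h
      rw [h]
      exact ⟨le_rfl, fun j hj => by exact_mod_cast hj⟩
    · rintro ⟨h, h'⟩
      obtain ⟨j, hj⟩ := ENat.ne_top_iff_exists.1 (ne_top_of_le_ne_top (ENat.natCast_ne_top n) h)
      rw [← hj] at h h' ⊢
      have h : j ≤ n := by exact_mod_cast h
      by_contra hne
      have := h' j (lt_of_le_of_ne h (by exact_mod_cast hne))
      exact lt_irrefl _ this
  rw [this]
  refine (measurableSet_omniTime_le hX k).diff (Finset.measurableSet_biUnion _ fun j hj => ?_)
  exact measurableSet_omniTime_le (fun i hi => hX i (hi.trans (Finset.mem_range.1 hj))) k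

theorem measurable_omniTime [MeasurableSpace Ω] {X : ℕ → Ω → α} (hX : ∀ i, Measurable (X i))
    (k : ℕ) : Measurable fun ω => omniTime k (fun i => X i ω) := by
  have h (n : ℕ) := measurableSet_omniTime_eq (n := n) (fun i _ => hX i) k
  refine measurable_to_countable' fun n => ?_
  cases n with
  | coe n => exact h n
  | top =>
    have : (fun ω => omniTime k (fun i => X i ω)) ⁻¹' {⊤} =
        (⋃ n : ℕ, {ω | omniTime k (fun i => X i ω) = n})ᶜ := by
      ext ω
      simp only [Set.mem_preimage, Set.mem_singleton_iff, Set.mem_compl_iff, Set.mem_iUnion,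
        Set.mem_ofPred_eq, not_exists]
      exact ⟨fun h n => by simp [h], fun h => by_contra fun h' =>
        let ⟨n, hn⟩ := ENat.ne_top_iff_exists.1 h'
        h n hn.symm⟩
    rw [this]
    exact (MeasurableSet.iUnion h).compl

end Measurability

/-! ### Exact law of the coupon collector's time; almost sure finiteness -/

/-- The letters `X 0, X 1, X 2, …` are independent and uniformly distributed on `Fin a`. -/
structure IsUniformIID {Ω : Type*} [MeasurableSpace Ω] {a : ℕ} (P : Measure Ω)
    (X : ℕ → Ω → Fin a) : Prop where
  measurable : ∀ n, Measurable (X n)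
  indep : iIndepFun X P
  unif : ∀ n, P.map (X n) = uniformOn Set.univ

namespace IsUniformIID

variable {Ω : Type*} [MeasurableSpace Ω] {a : ℕ} {P : Measure Ω} {X : ℕ → Ω → Fin a}

theorem shift (h : IsUniformIID P X) (m : ℕ) : IsUniformIID P fun n => X (m + n) where
  measurable _ := h.measurable _
  indep := h.indep.precomp (add_right_injective m)
  unif _ := h.unif _

theorem real_preimage (h : IsUniformIID P X) (n : ℕ) (u : Finset (Fin a)) :
    P.real (X n ⁻¹' u) = (u.card : ℝ) / a := by
  rw [← map_measureReal_apply (h.measurable n) (Finset.measurableSet u), h.unif, Measure.real,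
    uniformOn_univ, Measure.count_apply_finset]
  simp

variable [IsProbabilityMeasure P]

theorem real_preimage_compl (h : IsUniformIID P X) (n : ℕ) (u : Finset (Fin a)) :
    P.real (X n ⁻¹' (u : Set (Fin a))ᶜ) = 1 - (u.card : ℝ) / a := by
  rw [Set.preimage_compl, probReal_compl_eq_one_sub (h.measurable n (Finset.measurableSet u)),
    h.real_preimage]

theorem real_forall_notMem (h : IsUniformIID P X) (n : ℕ) (u : Finset (Fin a)) :
    P.real {ω | ∀ i < n, X i ω ∉ u} = (1 - (u.card : ℝ) / a) ^ n := by
  have : {ω | ∀ i < n, X i ω ∉ u} =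
      ⋂ i ∈ Finset.range n, X i ⁻¹' (u : Set (Fin a))ᶜ := by
    ext ω
    simp
  rw [this, Measure.real, h.indep.meas_biInter
    fun i _ => ⟨_, (Finset.measurableSet u).compl, rfl⟩, ENNReal.toReal_prod]
  change ∏ i ∈ Finset.range n, P.real (X i ⁻¹' (u : Set (Fin a))ᶜ) = _
  simp only [h.real_preimage_compl, Finset.prod_const, Finset.card_range]

/-- The distribution function of the coupon collector's time. -/
theorem real_omniTime_one_le (h : IsUniformIID P X) (n : ℕ) :
    P.real {ω | omniTime 1 (fun i => X i ω) ≤ n} =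
      ∑ j ∈ Finset.range (a + 1), (a.choose j : ℝ) * ((-1) ^ j * (1 - (j : ℝ) / a) ^ n) := by
  have hmeas (u : Finset (Fin a)) : MeasurableSet {ω | ∀ i < n, X i ω ∉ u} := by
    have : {ω | ∀ i < n, X i ω ∉ u} =
        ⋂ i ∈ Finset.range n, X i ⁻¹' (u : Set (Fin a))ᶜ := by
      ext ω
      simp
    rw [this]
    exact Finset.measurableSet_biInter _ fun i _ =>
      h.measurable i (Finset.measurableSet u).compl
  have hset : {ω | omniTime 1 (fun i => X i ω) ≤ n} =
      (⋃ c ∈ (Finset.univ : Finset (Fin a)), {ω | ∀ i < n, X i ω ∉ ({c} : Finset (Fin a))})ᶜ := by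
    ext ω
    simp [omniTime_one_le_iff]
  have hinter (u : Finset (Fin a)) :
      ⋂ c ∈ u, {ω | ∀ i < n, X i ω ∉ ({c} : Finset (Fin a))} = {ω | ∀ i < n, X i ω ∉ u} := by
    ext ω
    simp only [Finset.mem_singleton, Set.mem_iInter, Set.mem_ofPred_eq]
    exact ⟨fun H i hi hu => H _ hu i hi rfl, fun H c hc i hi e => H i hi (e ▸ hc)⟩
  have key := Finset.sum_powerset_apply_card (x := (Finset.univ : Finset (Fin a)))
    fun j => (-1 : ℝ) ^ j * (1 - (j : ℝ) / a) ^ n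
  simp only [Finset.card_univ, Fintype.card_fin, nsmul_eq_mul] at key
  rw [hset, probReal_compl_eq_one_sub (Finset.measurableSet_biUnion _ fun c _ => hmeas {c}),
    measureReal_biUnion_eq_sum_powerset fun c _ => hmeas {c}]
  simp only [hinter, h.real_forall_notMem]
  -- Inclusion–exclusion runs over nonempty sets of missing letters; the empty set supplies the `1`
  -- from the complement.
  rw [← key, ← Finset.sum_filter_add_sum_filter_not (Finset.univ : Finset (Fin a)).powerset
    (fun u : Finset (Fin a) => u.Nonempty)]
  have hempty : (Finset.univ : Finset (Fin a)).powerset.filter (fun u => ¬u.Nonempty) = {∅} := by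
    ext u
    simp
  rw [hempty, Finset.sum_singleton]
  simp only [pow_succ, Finset.card_empty, pow_zero, Nat.cast_zero, zero_div, sub_zero, one_pow,
    mul_one, mul_neg, neg_mul, Finset.sum_neg_distrib]
  ring

variable [NeZero a]

/-- In the exact formula every term with `j ≠ 0` decays geometrically in `n`. -/
theorem tendsto_real_omniTime_one_le (h : IsUniformIID P X) :
    Tendsto (fun n : ℕ => P.real {ω | omniTime 1 (fun i => X i ω) ≤ n}) atTop (𝓝 1) := by
  have hlim : Tendsto (fun n : ℕ => ∑ j ∈ Finset.range (a + 1),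
      (a.choose j : ℝ) * ((-1) ^ j * (1 - (j : ℝ) / a) ^ n)) atTop
      (𝓝 (∑ j ∈ Finset.range (a + 1), if j = 0 then 1 else 0)) := by
    refine tendsto_finsetSum _ fun j hj => ?_
    split_ifs with h0
    · simp [h0]
    · have ha : (0 : ℝ) < a := Nat.cast_pos.2 (Nat.pos_of_ne_zero (NeZero.ne a))
      have hja : (j : ℝ) ≤ a := by exact_mod_cast Nat.lt_succ_iff.1 (Finset.mem_range.1 hj)
      have hj0 : (0 : ℝ) < j := Nat.cast_pos.2 (Nat.pos_of_ne_zero h0)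
      have := tendsto_pow_atTop_nhds_zero_of_lt_one
        (r := 1 - (j : ℝ) / a) (sub_nonneg.2 ((div_le_one ha).2 hja))
        (sub_lt_self _ (div_pos hj0 ha))
      simpa using (this.const_mul _).const_mul _
  simp only [h.real_omniTime_one_le]
  simpa using hlim

theorem ae_omniTime_one_lt_top (h : IsUniformIID P X) :
    ∀ᵐ ω ∂P, omniTime 1 (fun i => X i ω) < ⊤ := by
  have hmeas : MeasurableSet {ω | omniTime 1 (fun i => X i ω) < ⊤} :=
    measurable_omniTime h.measurable 1 (MeasurableSet.of_discrete (s := Set.Iio ⊤))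
  have hone : P.real {ω | omniTime 1 (fun i => X i ω) < ⊤} = 1 := by
    refine le_antisymm measureReal_le_one (le_of_tendsto' h.tendsto_real_omniTime_one_le
      fun n => measureReal_mono fun ω hω => ?_)
    exact lt_of_le_of_lt hω (ENat.natCast_lt_top n)
  rw [ae_iff]
  change P {ω | omniTime 1 (fun i => X i ω) < ⊤}ᶜ = 0
  rw [prob_compl_eq_zero_iff hmeas, ← ENNReal.toReal_eq_one_iff]
  exact hone

theorem ae_omniTime_lt_top (k : ℕ) (h : IsUniformIID P X) :
    ∀ᵐ ω ∂P, omniTime k (fun i => X i ω) < ⊤ := by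
  induction k generalizing X with
  | zero => simp [omniTime_zero]
  | succ k ih =>
    filter_upwards [h.ae_omniTime_one_lt_top, ae_all_iff.2 fun m => ih (h.shift m)] with ω h₁ h₂
    obtain ⟨m, hm⟩ := ENat.ne_top_iff_exists.1 h₁.ne
    rw [omniTime_succ hm.symm, ENat.add_lt_top]
    exact ⟨ENat.natCast_lt_top m, h₂ m⟩

end IsUniformIID

/-! ### Independence of arches and characteristic functions -/

theorem setIntegral_eq_of_indep {Ω : Type*} {m₁ m₂ mΩ : MeasurableSpace Ω} {P : Measure Ω}
    [IsProbabilityMeasure P] (h₁ : m₁ ≤ mΩ) (h₂ : m₂ ≤ mΩ) (h : Indep m₁ m₂ P) {s : Set Ω}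
    (hs : MeasurableSet[m₁] s) {f : Ω → ℂ} (hf : Measurable[m₂] f) :
    ∫ ω in s, f ω ∂P = P.real s * ∫ ω, f ω ∂P := by
  have hind : IndepFun (s.indicator fun _ => (1 : ℂ)) f P := by
    refine indep_of_indep_of_le_left (indep_of_indep_of_le_right h hf.comap_le) ?_
    exact Measurable.comap_le (Measurable.indicator (m := m₁) measurable_const hs)
  have hprod : ∀ ω, s.indicator f ω = s.indicator (fun _ => (1 : ℂ)) ω * f ω := by
    intro ω
    by_cases hω : ω ∈ s <;> simp [hω]
  rw [← integral_indicator (h₁ s hs), integral_congr_ae (ae_of_all _ hprod),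
    hind.integral_fun_mul_eq_mul_integral
      ((measurable_const.indicator (h₁ s hs)).aestronglyMeasurable)
      (hf.mono h₂ le_rfl).aestronglyMeasurable, integral_indicator_const _ (h₁ s hs)]
  simp

namespace IsUniformIID

variable {Ω : Type*} [MeasurableSpace Ω] {a : ℕ} {P : Measure Ω} {X : ℕ → Ω → Fin a}

theorem measurable_toNat_omniTime (h : IsUniformIID P X) (k : ℕ) :
    Measurable fun ω => ((omniTime k fun i => X i ω).toNat : ℝ) :=
  (Measurable.of_discrete (f := fun n : ℕ∞ => (n.toNat : ℝ))).comp
    (measurable_omniTime h.measurable k)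

theorem charFun_toNat_omniTime_eq (h : IsUniformIID P X) (k : ℕ) (t : ℝ) :
    charFun (P.map fun ω => ((omniTime k fun i => X i ω).toNat : ℝ)) t =
      ∫ ω, Complex.exp (t * ((omniTime k fun i => X i ω).toNat : ℝ) * Complex.I) ∂P := by
  rw [charFun_apply_real, integral_map (h.measurable_toNat_omniTime k).aemeasurable]
  fun_prop

variable [IsProbabilityMeasure P]

/-- The event depends only on the letters before `m`, the integrand only on those from `m` on, and
these generate independent σ-algebras. -/
theorem setIntegral_omniTime_one_eq (h : IsUniformIID P X) (m k : ℕ) (f : ℕ∞ → ℂ) :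
    ∫ ω in {ω | omniTime 1 (fun i => X i ω) = m}, f (omniTime k fun i => X (m + i) ω) ∂P =
      P.real {ω | omniTime 1 (fun i => X i ω) = m} *
        ∫ ω, f (omniTime k fun i => X (m + i) ω) ∂P := by
  have hle (i : ℕ) : MeasurableSpace.comap (X i) inferInstance ≤ ‹MeasurableSpace Ω› :=
    (h.measurable i).comap_le
  have hind := indep_iSup_of_disjoint hle h.indep
    (S := Set.Iio m) (T := Set.Ici m) (Set.disjoint_left.2 fun i hi hi' => not_lt.2 (Set.mem_Ici.1 hi') hi)
  refine setIntegral_eq_of_indep (iSup₂_le fun i _ => hle i) (iSup₂_le fun i _ => hle i) hind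
    ?_ ?_
  · refine @measurableSet_omniTime_eq _ Ω _ _ _ (_) X m (fun i hi => ?_) 1
    rw [measurable_iff_comap_le]
    exact le_iSup₂_of_le (f := fun i (_ : i ∈ Set.Iio m) =>
      MeasurableSpace.comap (X i) inferInstance) i hi le_rfl
  · refine (Measurable.of_discrete (f := f)).comp
      (@measurable_omniTime _ Ω _ _ _ (_) (fun i => X (m + i)) (fun i => ?_) k)
    rw [measurable_iff_comap_le]
    exact le_iSup₂_of_le (f := fun i (_ : i ∈ Set.Ici m) =>
      MeasurableSpace.comap (X i) inferInstance) (m + i) (Nat.le_add_right m i) le_rfl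

theorem integrable_exp (h : IsUniformIID P X) (k : ℕ) (t : ℝ) :
    Integrable (fun ω =>
      Complex.exp (t * ((omniTime k fun i => X i ω).toNat : ℝ) * Complex.I)) P := by
  have hm := (Measurable.of_discrete (f := fun n : ℕ∞ => Complex.exp (t * (n.toNat : ℝ) *
    Complex.I))).comp (measurable_omniTime h.measurable k)
  refine Integrable.of_bound (C := 1) hm.aestronglyMeasurable (ae_of_all _ fun ω => ?_)
  rw [← Complex.ofReal_mul, Complex.norm_exp_ofReal_mul_I]

variable [NeZero a]

/-- Two sequences of independent uniform letters have the same coupon collector's time in law. -/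
theorem map_omniTime_one_eq {Y : ℕ → Ω → Fin a} (hX : IsUniformIID P X)
    (hY : IsUniformIID P Y) :
    P.map (fun ω => ((omniTime 1 fun i => X i ω).toNat : ℝ)) =
      P.map (fun ω => ((omniTime 1 fun i => Y i ω).toNat : ℝ)) := by
  have hmX := hX.measurable_toNat_omniTime 1
  have hmY := hY.measurable_toNat_omniTime 1
  have := Measure.isProbabilityMeasure_map (μ := P) hmX.aemeasurable
  have key {Z : ℕ → Ω → Fin a} (hZ : IsUniformIID P Z) (x : ℝ) :
      (P.map (fun ω => ((omniTime 1 fun i => Z i ω).toNat : ℝ))).real (Set.Iic x) =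
        if 0 ≤ x then P.real {ω | omniTime 1 (fun i => Z i ω) ≤ ⌊x⌋₊} else 0 := by
    rw [map_measureReal_apply (hZ.measurable_toNat_omniTime 1) measurableSet_Iic]
    split_ifs with hx
    · refine measureReal_congr ?_
      filter_upwards [hZ.ae_omniTime_one_lt_top] with ω hω
      obtain ⟨n, hn⟩ := ENat.ne_top_iff_exists.1 hω.ne
      refine propext (show ((omniTime 1 fun i => Z i ω).toNat : ℝ) ≤ x ↔
        omniTime 1 (fun i => Z i ω) ≤ ⌊x⌋₊ from ?_)
      rw [← hn, ENat.toNat_natCast, Nat.cast_le, Nat.le_floor_iff hx]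
    · rw [show (fun ω => ((omniTime 1 fun i => Z i ω).toNat : ℝ)) ⁻¹' Set.Iic x = ∅ from ?_,
        measureReal_empty]
      refine Set.eq_empty_of_forall_notMem fun ω hω => hx ?_
      exact (Nat.cast_nonneg _).trans hω
  refine Measure.ext_of_Iic _ _ fun x => ?_
  rw [← measureReal_eq_measureReal_iff, key hX, key hY, hX.real_omniTime_one_le,
    hY.real_omniTime_one_le]

/-- The waiting time for `k`-omnicity has the characteristic function of a sum of `k` independent
coupon collector's times. -/
theorem charFun_omniTime (h : IsUniformIID P X) (k : ℕ) (t : ℝ) :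
    charFun (P.map fun ω => ((omniTime k fun i => X i ω).toNat : ℝ)) t =
      charFun (P.map fun ω => ((omniTime 1 fun i => X i ω).toNat : ℝ)) t ^ k := by
  obtain ⟨φ, hφ⟩ : ∃ φ, φ = charFun (P.map fun ω => ((omniTime 1 fun i => X i ω).toNat : ℝ)) t :=
    ⟨_, rfl⟩
  rw [← hφ]
  -- Freeing `φ` from `X` lets one fixed `φ` serve all the shifted sequences met in the induction.
  replace hφ (Y : ℕ → Ω → Fin a) (hY : IsUniformIID P Y) :
      ∫ ω, Complex.exp (t * ((omniTime 1 fun i => Y i ω).toNat : ℝ) * Complex.I) ∂P = φ := by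
    rw [hφ, map_omniTime_one_eq h hY, hY.charFun_toNat_omniTime_eq]
  rw [h.charFun_toNat_omniTime_eq]
  induction k generalizing X with
  | zero => simp [omniTime_zero]
  | succ k ih =>
    have hpart (f : Ω → ℂ) (hf : Integrable f P) :
        ∫ ω, f ω ∂P = ∑' m : ℕ, ∫ ω in {ω | omniTime 1 (fun i => X i ω) = m}, f ω ∂P := by
      rw [← integral_iUnion (fun m => measurableSet_omniTime_eq (fun i _ => h.measurable i) 1) ?_
        hf.integrableOn, Measure.restrict_eq_self_of_ae_mem]
      · filter_upwards [h.ae_omniTime_one_lt_top] with ω hω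
        obtain ⟨m, hm⟩ := ENat.ne_top_iff_exists.1 hω.ne
        exact Set.mem_iUnion.2 ⟨m, hm.symm⟩
      · intro m n hmn
        refine Set.disjoint_left.2 fun ω hm hn => hmn ?_
        exact Nat.cast_injective (R := ℕ∞) (hm.symm.trans hn)
    have hmeas (m : ℕ) : MeasurableSet {ω | omniTime 1 (fun i => X i ω) = m} :=
      measurableSet_omniTime_eq (fun i _ => h.measurable i) 1
    have hstep (m : ℕ) : ∫ ω in {ω | omniTime 1 (fun i => X i ω) = m},
        Complex.exp (t * ((omniTime (k + 1) fun i => X i ω).toNat : ℝ) * Complex.I) ∂P =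
        (∫ ω in {ω | omniTime 1 (fun i => X i ω) = m},
          Complex.exp (t * ((omniTime 1 fun i => X i ω).toNat : ℝ) * Complex.I) ∂P) * φ ^ k := by
      have h₁ : ∫ ω in {ω | omniTime 1 (fun i => X i ω) = m},
          Complex.exp (t * ((omniTime (k + 1) fun i => X i ω).toNat : ℝ) * Complex.I) ∂P =
          ∫ ω in {ω | omniTime 1 (fun i => X i ω) = m}, Complex.exp (t * (m : ℝ) * Complex.I) *
            Complex.exp (t * ((omniTime k fun i => X (m + i) ω).toNat : ℝ) * Complex.I) ∂P := by
        refine setIntegral_congr_ae (hmeas m) ?_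
        filter_upwards [(h.shift m).ae_omniTime_lt_top k] with ω hω hm
        rw [omniTime_succ hm, ENat.toNat_add (ENat.natCast_ne_top m) hω.ne, ← Complex.exp_add]
        congr 1
        push_cast [ENat.toNat_natCast]
        ring
      have h₂ : ∫ ω in {ω | omniTime 1 (fun i => X i ω) = m},
          Complex.exp (t * ((omniTime 1 fun i => X i ω).toNat : ℝ) * Complex.I) ∂P =
          ∫ ω in {ω | omniTime 1 (fun i => X i ω) = m}, Complex.exp (t * (m : ℝ) * Complex.I)
            ∂P := by
        refine setIntegral_congr_fun (hmeas m) fun ω hm => ?_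
        simp only [Set.mem_ofPred_eq] at hm
        simp only [hm, ENat.toNat_natCast]
      rw [h₁, h₂, integral_const_mul, setIntegral_const,
        h.setIntegral_omniTime_one_eq m k fun n => Complex.exp (t * (n.toNat : ℝ) * Complex.I),
        ih (h.shift m), Complex.real_smul]
      ring
    rw [hpart _ (h.integrable_exp (k + 1) t)]
    simp only [hstep]
    rw [tsum_mul_right, ← hpart _ (h.integrable_exp 1 t), hφ X h, pow_succ, mul_comm]

end IsUniformIID

/-! ### Gumbel asymptotics of the inclusion–exclusion sum -/

/-- Squeeze by `1 - 1/y ≤ log y ≤ y - 1` at `y = 1 - j/a`: the two bounds differ by a term of order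
`n/a²`, which vanishes since `n/a = log a + O(1)`. -/
theorem tendsto_mul_log_one_sub_div {n : ℕ → ℕ} {x : ℝ}
    (hn : Tendsto (fun a : ℕ => (n a : ℝ) / a - Real.log a) atTop (𝓝 x)) (j : ℕ) :
    Tendsto (fun a : ℕ => j * Real.log a + n a * Real.log (1 - (j : ℝ) / a)) atTop
      (𝓝 (-(j * x))) := by
  have hinv : Tendsto (fun a : ℕ => (1 : ℝ) / a) atTop (𝓝 0) :=
    tendsto_one_div_atTop_nhds_zero_nat
  have hlog : Tendsto (fun a : ℕ => Real.log a / a) atTop (𝓝 0) := by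
    have := Real.isLittleO_log_id_atTop.tendsto_div_nhds_zero
    exact this.comp tendsto_natCast_atTop_atTop
  have hn2 : Tendsto (fun a : ℕ => (n a : ℝ) / a * (1 / a)) atTop (𝓝 0) := by
    have := (hn.mul hinv).add hlog
    simp only [mul_zero, add_zero] at this
    refine this.congr fun a => ?_
    ring
  have hden : Tendsto (fun a : ℕ => (1 : ℝ) - j * (1 / a)) atTop (𝓝 1) := by
    simpa using (hinv.const_mul (j : ℝ)).const_sub 1
  have herr : Tendsto (fun a : ℕ => -((j : ℝ) ^ 2 * ((n a : ℝ) / a * (1 / a)) /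
      (1 - j * (1 / a)))) atTop (𝓝 0) := by
    have := ((hn2.const_mul ((j : ℝ) ^ 2)).div hden one_ne_zero).neg
    simpa using this
  have hmain : Tendsto (fun a : ℕ => -(j * ((n a : ℝ) / a - Real.log a))) atTop
      (𝓝 (-(j * x))) := (hn.const_mul (j : ℝ)).neg
  have hsum := herr.add hmain
  rw [zero_add] at hsum
  refine tendsto_of_tendsto_of_tendsto_of_le_of_le' hsum hmain ?_ ?_
  · filter_upwards [eventually_gt_atTop j] with a ha
    have ha0 : (0 : ℝ) < a := Nat.cast_pos.2 (by omega)
    have hja : (j : ℝ) < a := Nat.cast_lt.2 ha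
    have hpos : 0 < 1 - (j : ℝ) / a := sub_pos.2 ((div_lt_one ha0).2 hja)
    have hl := Real.one_sub_inv_le_log_of_pos hpos
    have hmul := mul_le_mul_of_nonneg_left hl (Nat.cast_nonneg (α := ℝ) (n a))
    have he : (1 : ℝ) - (1 - (j : ℝ) / a)⁻¹ =
        -((j : ℝ) / a) - (j : ℝ) ^ 2 * (1 / a) * (1 / a) / (1 - (j : ℝ) / a) := by
      have hne : (a : ℝ) - j ≠ 0 := (sub_pos.2 hja).ne'
      field_simp
      ring
    rw [he] at hmul
    have he2 : (1 : ℝ) - j * (1 / a) = 1 - j / a := by ring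
    rw [he2]
    calc _ = j * Real.log a + n a * (-((j : ℝ) / a) -
        (j : ℝ) ^ 2 * (1 / a) * (1 / a) / (1 - (j : ℝ) / a)) := by ring
      _ ≤ _ := by linarith
  · filter_upwards [eventually_gt_atTop j] with a ha
    have ha0 : (0 : ℝ) < a := Nat.cast_pos.2 (by omega)
    have hja : (j : ℝ) < a := Nat.cast_lt.2 ha
    have hpos : 0 < 1 - (j : ℝ) / a := sub_pos.2 ((div_lt_one ha0).2 hja)
    have hl := Real.log_le_sub_one_of_pos hpos
    have hmul := mul_le_mul_of_nonneg_left hl (Nat.cast_nonneg (α := ℝ) (n a))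
    calc _ ≤ j * Real.log a + n a * (1 - (j : ℝ) / a - 1) := by linarith
      _ = _ := by ring

theorem tendsto_choose_mul_one_sub_div_pow {n : ℕ → ℕ} {x : ℝ}
    (hn : Tendsto (fun a : ℕ => (n a : ℝ) / a - Real.log a) atTop (𝓝 x)) (j : ℕ) :
    Tendsto (fun a : ℕ => (a.choose j : ℝ) * (1 - (j : ℝ) / a) ^ n a) atTop
      (𝓝 (Real.exp (-x) ^ j / j.factorial)) := by
  have hexp := (Real.continuous_exp.tendsto _).comp (tendsto_mul_log_one_sub_div hn j)
  have hpow : Tendsto (fun a : ℕ => (a : ℝ) ^ j * (1 - (j : ℝ) / a) ^ n a) atTop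
      (𝓝 (Real.exp (-x) ^ j)) := by
    rw [← Real.exp_nat_mul, mul_neg]
    refine hexp.congr' ?_
    filter_upwards [eventually_gt_atTop j] with a ha
    have ha0 : (0 : ℝ) < a := Nat.cast_pos.2 (by omega)
    have hja : (j : ℝ) < a := Nat.cast_lt.2 ha
    have hpos : 0 < 1 - (j : ℝ) / a := sub_pos.2 ((div_lt_one ha0).2 hja)
    rw [Function.comp_apply, Real.exp_add, Real.exp_nat_mul, Real.exp_nat_mul,
      Real.exp_log ha0, Real.exp_log hpos]
  have heq : Asymptotics.IsEquivalent atTop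
      (fun a : ℕ => (a.choose j : ℝ) * (1 - (j : ℝ) / a) ^ n a)
      (fun a : ℕ => (a : ℝ) ^ j / j.factorial * (1 - (j : ℝ) / a) ^ n a) :=
    (isEquivalent_choose j).mul Asymptotics.IsEquivalent.refl
  refine heq.tendsto_nhds_iff.2 ?_
  refine (hpow.div_const (j.factorial : ℝ)).congr fun a => ?_
  ring

/-- A summable bound independent of `a`, for dominated convergence. -/
theorem choose_mul_one_sub_div_pow_le {a n j : ℕ} {b : ℝ} (ha : 0 < a)
    (hb : b ≤ (n : ℝ) / a - Real.log a) (hj : j ≤ a) :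
    (a.choose j : ℝ) * (1 - (j : ℝ) / a) ^ n ≤ Real.exp (-b) ^ j / j.factorial := by
  have ha0 : (0 : ℝ) < a := Nat.cast_pos.2 ha
  have hnn : 0 ≤ 1 - (j : ℝ) / a := sub_nonneg.2 ((div_le_one ha0).2 (Nat.cast_le.2 hj))
  calc (a.choose j : ℝ) * (1 - (j : ℝ) / a) ^ n
      ≤ (a : ℝ) ^ j / j.factorial * Real.exp (-((j : ℝ) / a)) ^ n :=
        mul_le_mul (Nat.choose_le_pow_div j a)
          (pow_le_pow_left₀ hnn (Real.one_sub_le_exp_neg _) n) (by positivity) (by positivity)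
    _ = Real.exp (j * -((n : ℝ) / a - Real.log a)) / j.factorial := by
        rw [← Real.exp_nat_mul, div_mul_eq_mul_div, ← Real.exp_log ha0, ← Real.exp_nat_mul,
          ← Real.exp_add, Real.exp_log ha0]
        congr 2
        ring
    _ ≤ Real.exp (-b) ^ j / j.factorial := by
        rw [← Real.exp_nat_mul]
        gcongr

/-- The distribution function of the coupon collector's time is asymptotically Gumbel. -/
theorem tendsto_sum_choose_mul {n : ℕ → ℕ} {x : ℝ}
    (hn : Tendsto (fun a : ℕ => (n a : ℝ) / a - Real.log a) atTop (𝓝 x)) :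
    Tendsto (fun a : ℕ => ∑ j ∈ Finset.range (a + 1),
      (a.choose j : ℝ) * ((-1) ^ j * (1 - (j : ℝ) / a) ^ n a)) atTop
      (𝓝 (Real.exp (-Real.exp (-x)))) := by
  have hsum := tendsto_tsum_of_dominated_convergence (𝓕 := atTop)
    (f := fun (a j : ℕ) => (-1 : ℝ) ^ j * ((a.choose j : ℝ) * (1 - (j : ℝ) / a) ^ n a))
    -- Any number below `x` would do in place of `x - 1`: it only has to bound `n a / a - log a`
    -- from below eventually.
    (Real.summable_pow_div_factorial (Real.exp (-(x - 1))))
    (fun j => (tendsto_choose_mul_one_sub_div_pow hn j).const_mul ((-1 : ℝ) ^ j)) ?_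
  · have hexp : ∑' j : ℕ, (-1 : ℝ) ^ j * (Real.exp (-x) ^ j / j.factorial) =
        Real.exp (-Real.exp (-x)) := by
      generalize Real.exp (-x) = y
      rw [Real.exp_eq_exp_ℝ, NormedSpace.exp_eq_tsum_div]
      refine tsum_congr fun j => ?_
      rw [neg_pow y, mul_div_assoc]
    rw [hexp] at hsum
    refine hsum.congr fun a => ?_
    rw [tsum_eq_sum (s := Finset.range (a + 1)) fun j hj => ?_]
    · exact Finset.sum_congr rfl fun j _ => by ring
    · rw [Nat.choose_eq_zero_of_lt (by simpa using hj)]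
      simp
  · filter_upwards [eventually_gt_atTop 0, hn.eventually (eventually_ge_nhds (sub_one_lt x))]
      with a ha hb j
    rcases le_or_gt j a with hj | hj
    · have ha0 : (0 : ℝ) < a := Nat.cast_pos.2 ha
      have hnn : 0 ≤ 1 - (j : ℝ) / a := sub_nonneg.2 ((div_le_one ha0).2 (Nat.cast_le.2 hj))
      rw [norm_mul, norm_pow, norm_neg, norm_one, one_pow, one_mul, Real.norm_of_nonneg
        (by positivity)]
      exact choose_mul_one_sub_div_pow_le ha hb hj
    · rw [Nat.choose_eq_zero_of_lt hj]
      simp only [Nat.cast_zero, zero_mul, mul_zero, norm_zero]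
      positivity

theorem tendsto_floor_div_sub_log (x : ℝ) :
    Tendsto (fun a : ℕ => (⌊a * Real.log a + x * a⌋₊ : ℝ) / a - Real.log a) atTop (𝓝 x) := by
  have hinv : Tendsto (fun a : ℕ => x - (1 : ℝ) / a) atTop (𝓝 x) := by
    simpa using (tendsto_one_div_atTop_nhds_zero_nat (𝕜 := ℝ)).const_sub x
  have hlog : Tendsto (fun a : ℕ => Real.log a) atTop atTop :=
    Real.tendsto_log_atTop.comp tendsto_natCast_atTop_atTop
  refine tendsto_of_tendsto_of_tendsto_of_le_of_le' hinv tendsto_const_nhds ?_ ?_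
  · filter_upwards [eventually_gt_atTop 0] with a ha
    have ha0 : (0 : ℝ) < a := Nat.cast_pos.2 ha
    have h := (Nat.lt_floor_add_one (a * Real.log a + x * a)).le
    rw [le_sub_iff_add_le, le_div_iff₀ ha0]
    have : (x - 1 / (a : ℝ) + Real.log a) * a = a * Real.log a + x * a - 1 := by
      field_simp
      ring
    linarith
  · filter_upwards [eventually_gt_atTop 0, hlog.eventually_ge_atTop (-x)] with a ha hl
    have ha0 : (0 : ℝ) < a := Nat.cast_pos.2 ha
    have h := Nat.floor_le (a := a * Real.log a + x * a) (by nlinarith)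
    rw [sub_le_iff_le_add, div_le_iff₀ ha0]
    linarith

/-! ### Absence of atoms and weak convergence on the line -/

instance instNullSingletonClassGumbel : NullSingletonClass gumbelMeasure where
  measure_singleton x := by
    have hc : Continuous gumbelCDF := by
      change Continuous fun x : ℝ => Real.exp (-Real.exp (-x))
      fun_prop
    rw [gumbelMeasure, StieltjesFunction.measure_singleton,
      hc.continuousAt.continuousWithinAt.leftLim_eq, sub_self, ENNReal.ofReal_zero]

/-- By Fubini: once the other coordinates are fixed, the first is confined to a single point. -/
theorem pi_setOf_sum_eq_null (μ : Measure ℝ) [SigmaFinite μ] [NullSingletonClass μ] (k : ℕ) (x : ℝ) :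
    (Measure.pi fun _ : Fin (k + 1) => μ) {g | ∑ i, g i = x} = 0 := by
  have hmp := measurePreserving_piFinSuccAbove (fun _ : Fin (k + 1) => μ) 0
  have hs : MeasurableSet {p : ℝ × (Fin k → ℝ) | p.1 + ∑ i, p.2 i = x} :=
    measurableSet_eq_fun (by fun_prop) measurable_const
  have hpre : {g : Fin (k + 1) → ℝ | ∑ i, g i = x} =
      MeasurableEquiv.piFinSuccAbove (fun _ => ℝ) 0 ⁻¹'
        {p : ℝ × (Fin k → ℝ) | p.1 + ∑ i, p.2 i = x} := by
    ext g
    simp [MeasurableEquiv.piFinSuccAbove, Fin.sum_univ_succ, Fin.tail]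
  rw [hpre, hmp.measure_preimage hs.nullMeasurableSet, Measure.prod_apply_symm hs]
  refine (lintegral_congr fun y => ?_).trans lintegral_zero
  refine measure_mono_null (t := {x - ∑ i, y i}) (fun r hr => ?_) (measure_singleton _)
  exact eq_sub_of_add_eq hr

/-- Half-open intervals form a π-system containing small neighbourhoods of each point, and their
masses are differences of distribution functions. -/
theorem ProbabilityMeasure.tendsto_of_tendsto_Iic {ι : Type*} {l : Filter ι}
    [l.IsCountablyGenerated] {μ : ι → ProbabilityMeasure ℝ} {ν : ProbabilityMeasure ℝ}
    (h : ∀ x, Tendsto (fun i => (μ i : Measure ℝ).real (Set.Iic x)) l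
      (𝓝 ((ν : Measure ℝ).real (Set.Iic x)))) : Tendsto μ l (𝓝 ν) := by
  have hIoc (ρ : ProbabilityMeasure ℝ) {b c : ℝ} (hbc : b < c) :
      ((ρ (Set.Ioc b c) : NNReal) : ℝ) =
        (ρ : Measure ℝ).real (Set.Iic c) - (ρ : Measure ℝ).real (Set.Iic b) := by
    rw [← measureReal_sdiff (Set.Iic_subset_Iic.2 hbc.le) measurableSet_Iic, Set.Iic_sdiff_Iic]
    rfl
  refine (isPiSystem_Ioc (id : ℝ → ℝ) id).tendsto_probabilityMeasure_of_tendsto_of_mem ?_ ?_ ?_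
  · rintro _ ⟨b, c, -, rfl⟩
    exact measurableSet_Ioc
  · intro u hu x hx
    obtain ⟨ε, hε, hball⟩ := Metric.isOpen_iff.1 hu x hx
    refine ⟨Set.Ioc (x - ε / 2) (x + ε / 2), ⟨_, _, by simp only [id]; linarith, rfl⟩,
      Ioc_mem_nhds (by linarith) (by linarith), fun y hy => hball ?_⟩
    rw [Metric.mem_ball, Real.dist_eq, abs_lt]
    constructor <;> linarith [hy.1, hy.2]
  · rintro _ ⟨b, c, hbc, rfl⟩
    rw [← NNReal.tendsto_coe]
    simp only [id] at hbc ⊢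
    simp only [hIoc _ hbc]
    exact (h c).sub (h b)

theorem charFun_map_affine {Ω : Type*} [MeasurableSpace Ω] {P : Measure Ω} {f : Ω → ℝ}
    (hf : Measurable f) (r c t : ℝ) :
    charFun (P.map fun ω => r * f ω + c) t =
      charFun (P.map f) (r * t) * Complex.exp (t * c * Complex.I) := by
  rw [← charFun_map_mul_comp hf.aemeasurable,
    show (fun ω => r * f ω + c) = (· + c) ∘ fun ω => r * f ω from rfl,
    ← Measure.map_map (by fun_prop) (by fun_prop), charFun_map_add_const]
  simp

/-! ### The normalized waiting time -/

namespace IsUniformIID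

variable {Ω : Type*} [MeasurableSpace Ω] {a : ℕ} {P : Measure Ω} {X : ℕ → Ω → Fin a}

theorem measurable_normalized (h : IsUniformIID P X) (k : ℕ) :
    Measurable fun ω => (a : ℝ)⁻¹ * ((omniTime k fun i => X i ω).toNat : ℝ) +
      -(k * Real.log a) :=
  ((h.measurable_toNat_omniTime k).const_mul _).add_const _

variable [IsProbabilityMeasure P]

/-- The law of the centred and rescaled waiting time. -/
noncomputable def law (h : IsUniformIID P X) (k : ℕ) : ProbabilityMeasure ℝ :=
  ⟨P.map fun ω => (a : ℝ)⁻¹ * ((omniTime k fun i => X i ω).toNat : ℝ) + -(k * Real.log a),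
    Measure.isProbabilityMeasure_map (h.measurable_normalized k).aemeasurable⟩

variable [NeZero a]

/-- The centring `k log a` is linear in `k`, so its phase factor is a `k`th power too. -/
theorem charFun_law (h : IsUniformIID P X) (k : ℕ) (t : ℝ) :
    charFun (h.law k : Measure ℝ) t = charFun (h.law 1 : Measure ℝ) t ^ k := by
  simp only [law, ProbabilityMeasure.coe_mk]
  rw [charFun_map_affine (h.measurable_toNat_omniTime k),
    charFun_map_affine (h.measurable_toNat_omniTime 1), h.charFun_omniTime, mul_pow,
    ← Complex.exp_nat_mul]
  congr 2
  push_cast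
  ring

theorem real_law_Iic (h : IsUniformIID P X) (k : ℕ) (x : ℝ) :
    (h.law k : Measure ℝ).real (Set.Iic x) =
      P.real {ω | ∃ W : ℕ, omniTime k (fun i => X i ω) = (W : ℕ∞) ∧
        ((W : ℝ) - (k : ℝ) * (a : ℝ) * Real.log (a : ℝ)) / (a : ℝ) ≤ x} := by
  simp only [law, ProbabilityMeasure.coe_mk]
  rw [map_measureReal_apply (h.measurable_normalized k) measurableSet_Iic]
  -- The events agree only almost surely, since `toNat` sends `⊤` to `0`.
  refine measureReal_congr ?_
  filter_upwards [h.ae_omniTime_lt_top k] with ω hω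
  obtain ⟨n, hn⟩ := ENat.ne_top_iff_exists.1 hω.ne
  refine propext (show (a : ℝ)⁻¹ * ((omniTime k fun i => X i ω).toNat : ℝ) +
    -(k * Real.log a) ≤ x ↔ ∃ W : ℕ, omniTime k (fun i => X i ω) = (W : ℕ∞) ∧
        ((W : ℝ) - (k : ℝ) * (a : ℝ) * Real.log (a : ℝ)) / (a : ℝ) ≤ x from ?_)
  have ha : (a : ℝ) ≠ 0 := Nat.cast_ne_zero.2 (NeZero.ne a)
  have he : ((n : ℝ) - (k : ℝ) * (a : ℝ) * Real.log (a : ℝ)) / (a : ℝ) =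
      (a : ℝ)⁻¹ * n + -(k * Real.log a) := by
    field_simp
    ring
  simp [← hn, ← he]

theorem real_law_one_Iic (h : IsUniformIID P X) {x : ℝ} (hx : 0 ≤ a * Real.log a + x * a) :
    (h.law 1 : Measure ℝ).real (Set.Iic x) = ∑ j ∈ Finset.range (a + 1),
      (a.choose j : ℝ) * ((-1) ^ j *
        (1 - (j : ℝ) / a) ^ ⌊a * Real.log a + x * a⌋₊) := by
  rw [real_law_Iic, ← h.real_omniTime_one_le]
  congr 1
  ext ω
  have ha : (0 : ℝ) < a := Nat.cast_pos.2 (Nat.pos_of_ne_zero (NeZero.ne a))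
  have hW (W : ℕ) : ((W : ℝ) - ((1 : ℕ) : ℝ) * (a : ℝ) * Real.log (a : ℝ)) / (a : ℝ) ≤ x ↔
      W ≤ ⌊a * Real.log a + x * a⌋₊ := by
    rw [Nat.le_floor_iff hx, div_le_iff₀ ha, sub_le_iff_le_add, Nat.cast_one, one_mul, add_comm]
  simp only [Set.mem_ofPred_eq, hW]
  constructor
  · rintro ⟨W, h₁, h₂⟩
    rw [h₁]
    exact_mod_cast h₂
  · intro hle
    obtain ⟨W, hn⟩ := ENat.ne_top_iff_exists.1 (ne_top_of_le_ne_top (ENat.natCast_ne_top _) hle)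
    rw [← hn] at hle
    exact ⟨W, hn.symm, by exact_mod_cast hle⟩

end IsUniformIID

/-! ### Passage to the limit -/

section Limit

variable {Ω : ℕ+ → Type*} [∀ a, MeasurableSpace (Ω a)]
  {P : (a : ℕ+) → Measure (Ω a)} [∀ a, IsProbabilityMeasure (P a)]
  {X : (a : ℕ+) → ℕ → Ω a → Fin (a : ℕ)}

theorem tendsto_law_one (h : ∀ a, IsUniformIID (P a) (X a)) :
    Tendsto (fun a => (h a).law 1) atTop (𝓝 ⟨gumbelMeasure, inferInstance⟩) := by
  refine ProbabilityMeasure.tendsto_of_tendsto_Iic fun x => ?_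
  have hlim : (gumbelMeasure.real (Set.Iic x)) = Real.exp (-Real.exp (-x)) := by
    rw [Measure.real, gumbelMeasure_Iic, ENNReal.toReal_ofReal (Real.exp_nonneg _)]
  have hval : Tendsto (fun a : ℕ+ => (a : ℕ)) atTop atTop := tendsto_PNat_val_atTop_atTop
  have hlog : Tendsto (fun a : ℕ => Real.log a) atTop atTop :=
    Real.tendsto_log_atTop.comp tendsto_natCast_atTop_atTop
  change Tendsto _ _ (𝓝 (gumbelMeasure.real (Set.Iic x)))
  rw [hlim]
  refine ((tendsto_sum_choose_mul (tendsto_floor_div_sub_log x)).comp hval).congr' ?_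
  filter_upwards [hval.eventually (hlog.eventually_ge_atTop (-x))] with a ha
  rw [(h a).real_law_one_Iic, Function.comp_apply]
  have ha0 : (0 : ℝ) < (a : ℕ) := Nat.cast_pos.2 a.pos
  nlinarith

/-- The law of the sum of `k` independent standard Gumbel variables. -/
noncomputable def gumbelSum (k : ℕ) : ProbabilityMeasure ℝ :=
  ⟨(Measure.pi fun _ : Fin k => gumbelMeasure).map fun g => ∑ i, g i,
    Measure.isProbabilityMeasure_map (by fun_prop)⟩

theorem gumbelSum_real_Iic (k : ℕ) (x : ℝ) :
    (gumbelSum k : Measure ℝ).real (Set.Iic x) = gumbelSumCDF k x := by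
  rw [gumbelSum, ProbabilityMeasure.coe_mk, map_measureReal_apply (by fun_prop) measurableSet_Iic]
  rfl

theorem tendsto_law (h : ∀ a, IsUniformIID (P a) (X a)) (k : ℕ) :
    Tendsto (fun a => (h a).law k) atTop (𝓝 (gumbelSum k)) := by
  -- The continuity theorem is applied along sequences, whereas `a` ranges over `ℕ+`.
  refine tendsto_of_seq_tendsto fun u hu => ?_
  refine ProbabilityMeasure.tendsto_of_tendsto_charFun fun t => ?_
  have hone := ProbabilityMeasure.tendsto_iff_tendsto_charFun.1 ((tendsto_law_one h).comp hu) t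
  have hsum : charFun (gumbelSum k : Measure ℝ) t = charFun gumbelMeasure t ^ k := by
    rw [gumbelSum, ProbabilityMeasure.coe_mk, charFun_map_sum_pi_eq_prod]
    simp
  rw [hsum]
  exact (hone.pow k).congr fun n => ((h (u n)).charFun_law k t).symm

end Limit

theorem gumbelSum_singleton (k : ℕ) (x : ℝ) : (gumbelSum (k + 1) : Measure ℝ) {x} = 0 := by
  rw [gumbelSum, ProbabilityMeasure.coe_mk, Measure.map_apply (by fun_prop)
    (measurableSet_singleton x)]
  exact pi_setOf_sum_eq_null gumbelMeasure k x

theorem theorem5p2 {Ω : ℕ+ → Type*} [∀ a, MeasurableSpace (Ω a)]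
    (P : (a : ℕ+) → Measure (Ω a)) [∀ a, IsProbabilityMeasure (P a)]
    (X : (a : ℕ+) → ℕ → Ω a → Fin (a : ℕ))
    (hX_meas : ∀ a n, Measurable (X a n))
    (hX_indep : ∀ a, iIndepFun (X a) (P a))
    (hX_unif : ∀ a n, (P a).map (X a n) = uniformOn Set.univ)
    (k : ℕ) :
    (∀ a, ∀ᵐ ω ∂(P a), omniTime k (fun n => X a n ω) < ⊤) ∧
    ∀ x : ℝ,
      Tendsto
        (fun a : ℕ+ => (P a).real
          {ω | ∃ W : ℕ, omniTime k (fun n => X a n ω) = (W : ℕ∞) ∧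
            ((W : ℝ) - (k : ℝ) * ((a : ℕ) : ℝ) * Real.log ((a : ℕ) : ℝ)) / ((a : ℕ) : ℝ) ≤ x})
        atTop (𝓝 (gumbelSumCDF k x)) := by
  have h (a : ℕ+) : IsUniformIID (P a) (X a) := ⟨hX_meas a, hX_indep a, hX_unif a⟩
  refine ⟨fun a => (h a).ae_omniTime_lt_top k, fun x => ?_⟩
  -- The empty sum has an atom at `0`, where weak convergence alone would not suffice; for `k = 0`
  -- the probabilities are constant in `a`.
  cases k with
  | zero =>
    refine Tendsto.congr (f₁ := fun _ => gumbelSumCDF 0 x) (fun a => ?_) tendsto_const_nhds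
    have hW (W : ℕ) : (0 : ℕ∞) = W ↔ W = 0 := by
      rw [eq_comm, Nat.cast_eq_zero]
    by_cases hx : 0 ≤ x <;> simp [gumbelSumCDF, omniTime_zero, hW, hx]
  | succ k =>
    simp only [← (h _).real_law_Iic, ← gumbelSum_real_Iic]
    refine (ENNReal.tendsto_toReal (measure_ne_top _ _)).comp
      (ProbabilityMeasure.tendsto_measure_of_null_frontier_of_tendsto' (tendsto_law h (k + 1)) ?_)
    rw [frontier_Iic]
    exact gumbelSum_singleton k x
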